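/- Let $d\in\{1,2,3\}$, $p\ge 1$, and let $\Omega\subset\mathbb R^d$ be a bounded convex Lipschitz domain. Put $L=[L^2(\Omega)]^p$ and $H=[H^1_0(\Omega)]^p$ (real-valued functions). Let $V_1,\dots,V_p\in L^\infty(\Omega)$ with $V_j(x)\ge 0$ for almost every $x\in\Omega$, let $K=[\kappa_{ij}]\in\mathbb R^{p\times p}$ be an arbitrary real matrix, and fix $\varphi=(\varphi_1,\dots,\varphi_p)\in H$. For $v,w\in H$ set $$\|v\|_L^2=\sum_{j=1}^p\int_\Omega |v_j|^2\,dx,\qquad \|v\|_H^2=\sum_{j=1}^p\int_\Omega |\nabla v_j|^2+V_j|v_j|^2\,dx,$$ $$\rho_j(\varphi)=\sum_{i=1}^p\kappa_{ij}|\varphi_i|^2,\qquad a_\varphi(v,w)=\sum_{j=1}^p\int_\Omega \nabla v_j\cdot\nabla w_j+V_j\,v_jw_j+\rho_j(\varphi)\,v_jw_j\,dx .$$ Then the integrands in $a_\varphi(v,w)$ are integrable for all $v,w\in H$, and $a_\varphi\colon H\times H\to\mathbb R$ is a bilinear form which 1. is symmetric: $a_\varphi(v,w)=a_\varphi(w,v)$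 for all $v,w\in H$; 2. is bounded: there is a constant $M$ (depending on $\varphi$ and the data) with $|a_\varphi(v,w)|\le M\,\|v\|_H\,\|w\|_H$ for all $v,w\in H$; 3. satisfies a Gårding inequality: there is a constant $C(\varphi)>0$ (also depending on the data) such that $$a_\varphi(v,v)\ \ge\ \tfrac12\,\|v\|_H^2-C(\varphi)\,\|v\|_L^2\qquad\text{for all } v\in H .$$ -/

import Mathlib

open MeasureTheory Filter Topology TopologicalSpace
open scoped ENNReal Gradient Distributions ContDiff

noncomputable section

namespace GrossPitaevskii

/-- `ℝᵈ` with the Euclidean norm and Lebesgue measure. -/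
abbrev Space (d : ℕ) : Type := EuclideanSpace ℝ (Fin d)

/-- `L²(Ω)`, real valued. -/
abbrev L2 {d : ℕ} (Ω : Opens (Space d)) : Type :=
  Lp ℝ 2 (volume.restrict (Ω : Set (Space d)))

/-- `L²(Ω; ℝᵈ)`. -/
abbrev L2Vec {d : ℕ} (Ω : Opens (Space d)) : Type :=
  Lp (Space d) 2 (volume.restrict (Ω : Set (Space d)))

/-- `g` is the weak gradient of `u` in `Ω`: `∫_Ω u ∇ψ = - ∫_Ω ψ g` (an identity of vectors of `ℝᵈ`,
i.e. one scalar identity for each partial derivative) for all test functions `ψ ∈ C_c^∞(Ω)`. -/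
def IsWeakGradient {d : ℕ} (Ω : Opens (Space d)) (u : L2 Ω) (g : L2Vec Ω) : Prop :=
  ∀ ψ : 𝓓(Ω, ℝ),
    ∫ x in (Ω : Set (Space d)), u x • ∇ ψ x = - ∫ x in (Ω : Set (Space d)), ψ x • g x

/-- The test functions `ψ n ∈ C_c^∞(Ω)` converge to `u` in the `H¹`-norm, where `g` is the gradient
of `u`: `ψ n → u` in `L²(Ω)` and `∇ ψ n → g` in `L²(Ω; ℝᵈ)`. -/
def TendstoH1 {d : ℕ} {Ω : Opens (Space d)} (ψ : ℕ → 𝓓(Ω, ℝ)) (u : L2 Ω) (g : L2Vec Ω) : Prop :=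
  Tendsto (fun n => eLpNorm (fun x => ψ n x - u x) 2 (volume.restrict (Ω : Set (Space d))))
    atTop (𝓝 0) ∧
  Tendsto (fun n => eLpNorm (fun x => ∇ (ψ n) x - g x) 2 (volume.restrict (Ω : Set (Space d))))
    atTop (𝓝 0)

section Helpers

variable {d : ℕ} {Ω : Opens (Space d)}

lemma continuous_gradient (ψ : 𝓓(Ω, ℝ)) : Continuous (∇ ψ) :=
  (InnerProductSpace.toDual ℝ (Space d)).symm.continuous.comp
    (ψ.contDiff.continuous_fderiv (by simp))

lemma hasCompactSupport_gradient (ψ : 𝓓(Ω, ℝ)) : HasCompactSupport (∇ ψ) :=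
  (ψ.hasCompactSupport.fderiv (𝕜 := ℝ)).comp_left
    (g := (InnerProductSpace.toDual ℝ (Space d)).symm) (by simp)

lemma memLp_gradient (ψ : 𝓓(Ω, ℝ)) :
    MemLp (∇ ψ) 2 (volume.restrict (Ω : Set (Space d))) :=
  ((continuous_gradient ψ).memLp_of_hasCompactSupport (hasCompactSupport_gradient ψ)).restrict _

lemma memLp_test (ψ : 𝓓(Ω, ℝ)) :
    MemLp ψ 2 (volume.restrict (Ω : Set (Space d))) :=
  (ψ.continuous.memLp_of_hasCompactSupport ψ.hasCompactSupport).restrict _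

lemma integrable_smul_gradient (u : L2 Ω) (ψ : 𝓓(Ω, ℝ)) :
    Integrable (fun x => u x • ∇ ψ x) (volume.restrict (Ω : Set (Space d))) :=
  memLp_one_iff_integrable.1 ((memLp_gradient ψ).smul (Lp.memLp u))

lemma integrable_test_smul (g : L2Vec Ω) (ψ : 𝓓(Ω, ℝ)) :
    Integrable (fun x => ψ x • g x) (volume.restrict (Ω : Set (Space d))) :=
  memLp_one_iff_integrable.1 ((Lp.memLp g).smul (memLp_test ψ))

lemma gradient_add (ψ χ : 𝓓(Ω, ℝ)) (x : Space d) : ∇ (ψ + χ) x = ∇ ψ x + ∇ χ x := by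
  have h1 : DifferentiableAt ℝ ψ x := ψ.contDiff.differentiable (by simp) x
  have h2 : DifferentiableAt ℝ χ x := χ.contDiff.differentiable (by simp) x
  simp only [gradient, FunLike.coe_add, fderiv_add h1 h2, map_add]

lemma gradient_smul (c : ℝ) (ψ : 𝓓(Ω, ℝ)) (x : Space d) : ∇ (c • ψ) x = c • ∇ ψ x := by
  have h1 : DifferentiableAt ℝ ψ x := ψ.contDiff.differentiable (by simp) x
  simp [gradient, FunLike.coe_smul, fderiv_const_smul h1]

lemma IsWeakGradient.add {u v : L2 Ω} {g h : L2Vec Ω} (hu : IsWeakGradient Ω u g)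
    (hv : IsWeakGradient Ω v h) : IsWeakGradient Ω (u + v) (g + h) := by
  intro ψ
  have e1 : ∫ x in (Ω : Set (Space d)), (u + v : L2 Ω) x • ∇ ψ x
      = ∫ x in (Ω : Set (Space d)), (u x • ∇ ψ x + v x • ∇ ψ x) := by
    apply integral_congr_ae
    filter_upwards [Lp.coeFn_add u v] with x hx
    rw [hx, Pi.add_apply, add_smul]
  have e2 : ∫ x in (Ω : Set (Space d)), ψ x • (g + h : L2Vec Ω) x
      = ∫ x in (Ω : Set (Space d)), (ψ x • g x + ψ x • h x) := by
    apply integral_congr_ae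
    filter_upwards [Lp.coeFn_add g h] with x hx
    rw [hx, Pi.add_apply, smul_add]
  rw [e1, e2, integral_add (integrable_smul_gradient u ψ) (integrable_smul_gradient v ψ),
    integral_add (integrable_test_smul g ψ) (integrable_test_smul h ψ), hu ψ, hv ψ, neg_add]

lemma IsWeakGradient.smul {u : L2 Ω} {g : L2Vec Ω} (c : ℝ) (hu : IsWeakGradient Ω u g) :
    IsWeakGradient Ω (c • u) (c • g) := by
  intro ψ
  have e1 : ∫ x in (Ω : Set (Space d)), (c • u : L2 Ω) x • ∇ ψ x
      = ∫ x in (Ω : Set (Space d)), c • (u x • ∇ ψ x) := by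
    apply integral_congr_ae
    filter_upwards [Lp.coeFn_smul c u] with x hx
    rw [hx, Pi.smul_apply, smul_assoc]
  have e2 : ∫ x in (Ω : Set (Space d)), ψ x • (c • g : L2Vec Ω) x
      = ∫ x in (Ω : Set (Space d)), c • (ψ x • g x) := by
    apply integral_congr_ae
    filter_upwards [Lp.coeFn_smul c g] with x hx
    rw [hx, Pi.smul_apply, smul_comm]
  rw [e1, e2, integral_smul, integral_smul, hu ψ, smul_neg]

lemma IsWeakGradient.zero : IsWeakGradient Ω (0 : L2 Ω) (0 : L2Vec Ω) := by
  intro ψ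
  have e1 : ∫ x in (Ω : Set (Space d)), (0 : L2 Ω) x • ∇ ψ x = 0 := by
    apply integral_eq_zero_of_ae
    filter_upwards [Lp.coeFn_zero ℝ 2 (volume.restrict (Ω : Set (Space d)))] with x hx
    rw [hx]; simp
  have e2 : ∫ x in (Ω : Set (Space d)), ψ x • (0 : L2Vec Ω) x = 0 := by
    apply integral_eq_zero_of_ae
    filter_upwards [Lp.coeFn_zero (Space d) 2 (volume.restrict (Ω : Set (Space d)))] with x hx
    rw [hx]; simp
  rw [e1, e2, neg_zero]

/-- The weak gradient is unique. -/
lemma IsWeakGradient.unique {u : L2 Ω} {g h : L2Vec Ω} (hg : IsWeakGradient Ω u g)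
    (hh : IsWeakGradient Ω u h) : g = h := by
  have key : ∀ᵐ x ∂(volume : Measure (Space d)), x ∈ (Ω : Set (Space d)) → g x - h x = 0 := by
    refine Ω.isOpen.ae_eq_zero_of_integral_contDiff_smul_eq_zero
      (f := fun x => g x - h x) ?_ ?_
    · have hl : MemLp (fun x => g x - h x) 2 (volume.restrict (Ω : Set (Space d))) :=
        (Lp.memLp g).sub (Lp.memLp h)
      exact locallyIntegrableOn_of_locallyIntegrable_restrict
        (hl.locallyIntegrable (by norm_num))
    · intro φ h1 h2 h3
      let ψ : 𝓓(Ω, ℝ) := ⟨φ, h1, h2, h3⟩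
      have e : ∫ x in (Ω : Set (Space d)), ψ x • (g x - h x) = 0 := by
        simp only [smul_sub]
        rw [integral_sub (integrable_test_smul g ψ) (integrable_test_smul h ψ)]
        have := (hg ψ).symm.trans (hh ψ)
        rw [neg_inj] at this
        rw [this, sub_self]
      rw [← e, setIntegral_eq_integral_of_forall_compl_eq_zero]
      · rfl
      · intro x hx
        have : ψ x = 0 := image_eq_zero_of_notMem_tsupport (fun hx' => hx (h3 hx'))
        rw [this, zero_smul]
  apply Lp.ext
  rw [← ae_restrict_iff' Ω.isOpen.measurableSet] at key
  filter_upwards [key] with x hx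
  exact sub_eq_zero.1 hx

lemma TendstoH1.add {ψ χ : ℕ → 𝓓(Ω, ℝ)} {u v : L2 Ω} {g h : L2Vec Ω} (hu : TendstoH1 ψ u g)
    (hv : TendstoH1 χ v h) : TendstoH1 (fun n => ψ n + χ n) (u + v) (g + h) := by
  constructor
  · refine tendsto_of_tendsto_of_tendsto_of_le_of_le tendsto_const_nhds
      (by simpa using hu.1.add hv.1) (fun _ => zero_le) (fun n => ?_)
    refine le_trans (le_of_eq (eLpNorm_congr_ae ?_)) (eLpNorm_add_le
      ((memLp_test (ψ n)).sub (Lp.memLp u)).1 ((memLp_test (χ n)).sub (Lp.memLp v)).1 (by norm_num))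
    filter_upwards [Lp.coeFn_add u v] with x hx
    simp only [hx, Pi.add_apply, FunLike.coe_add]
    ring
  · refine tendsto_of_tendsto_of_tendsto_of_le_of_le tendsto_const_nhds
      (by simpa using hu.2.add hv.2) (fun _ => zero_le) (fun n => ?_)
    refine le_trans (le_of_eq (eLpNorm_congr_ae ?_)) (eLpNorm_add_le
      ((memLp_gradient (ψ n)).sub (Lp.memLp g)).1
      ((memLp_gradient (χ n)).sub (Lp.memLp h)).1 (by norm_num))
    filter_upwards [Lp.coeFn_add g h] with x hx
    simp only [hx, Pi.add_apply, gradient_add]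
    abel

lemma TendstoH1.smul {ψ : ℕ → 𝓓(Ω, ℝ)} {u : L2 Ω} {g : L2Vec Ω} (c : ℝ)
    (hu : TendstoH1 ψ u g) : TendstoH1 (fun n => c • ψ n) (c • u) (c • g) := by
  constructor
  · have h := ENNReal.Tendsto.const_mul (a := ‖c‖ₑ) hu.1 (Or.inr enorm_ne_top)
    rw [mul_zero] at h
    refine h.congr (fun n => ?_)
    rw [← eLpNorm_const_smul]
    apply eLpNorm_congr_ae
    filter_upwards [Lp.coeFn_smul c u] with x hx
    simp only [hx, Pi.smul_apply, FunLike.coe_smul, smul_sub]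
  · have h := ENNReal.Tendsto.const_mul (a := ‖c‖ₑ) hu.2 (Or.inr enorm_ne_top)
    rw [mul_zero] at h
    refine h.congr (fun n => ?_)
    rw [← eLpNorm_const_smul]
    apply eLpNorm_congr_ae
    filter_upwards [Lp.coeFn_smul c g] with x hx
    simp only [hx, Pi.smul_apply, gradient_smul, smul_sub]

lemma TendstoH1.zero : TendstoH1 (fun _ => (0 : 𝓓(Ω, ℝ))) (0 : L2 Ω) (0 : L2Vec Ω) := by
  constructor
  · refine tendsto_const_nhds.congr (fun _ => (Eq.symm ?_))
    rw [← eLpNorm_zero (ε := ℝ) (p := 2) (μ := volume.restrict (Ω : Set (Space d)))]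
    apply eLpNorm_congr_ae
    filter_upwards [Lp.coeFn_zero ℝ 2 (volume.restrict (Ω : Set (Space d)))] with x hx
    rw [hx]; simp
  · refine tendsto_const_nhds.congr (fun _ => (Eq.symm ?_))
    rw [← eLpNorm_zero (ε := Space d) (p := 2) (μ := volume.restrict (Ω : Set (Space d)))]
    apply eLpNorm_congr_ae
    filter_upwards [Lp.coeFn_zero (Space d) 2 (volume.restrict (Ω : Set (Space d)))] with x hx
    rw [hx]; simp [gradient, FunLike.coe_zero]

end Helpers

/-- `H¹₀(Ω)`: the closure of `C_c^∞(Ω)` in `H¹(Ω)`, as a linear subspace of `L²(Ω)`. Its elements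
are the `u ∈ L²(Ω)` that have a weak gradient `g ∈ L²(Ω; ℝᵈ)` and are the limit, in the `H¹`-norm,
of a sequence of test functions. (The norm that Lean puts on this subspace is that of `L²(Ω)`; it
is not used. The norm of `H = [H¹₀(Ω)]ᵖ` is `normH` below.) -/
def H10 {d : ℕ} (Ω : Opens (Space d)) : Submodule ℝ (L2 Ω) where
  carrier := {u | ∃ g : L2Vec Ω, IsWeakGradient Ω u g ∧ ∃ ψ : ℕ → 𝓓(Ω, ℝ), TendstoH1 ψ u g}
  zero_mem' := ⟨0, IsWeakGradient.zero, _, TendstoH1.zero⟩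
  add_mem' := by
    rintro u v ⟨g, hg, ψ, hψ⟩ ⟨h, hh, χ, hχ⟩
    exact ⟨g + h, hg.add hh, _, hψ.add hχ⟩
  smul_mem' := by
    rintro c u ⟨g, hg, ψ, hψ⟩
    exact ⟨c • g, hg.smul c, _, hψ.smul c⟩

/-- The weak gradient `∇v ∈ L²(Ω; ℝᵈ)` of `v ∈ H¹₀(Ω)`; it is unique by
`IsWeakGradient.unique`. -/
def grad {d : ℕ} {Ω : Opens (Space d)} (v : H10 Ω) : L2Vec Ω :=
  v.2.choose

lemma grad_spec {d : ℕ} {Ω : Opens (Space d)} (v : H10 Ω) : IsWeakGradient Ω v.1 (grad v) :=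
  v.2.choose_spec.1

/-- The space `H = [H¹₀(Ω)]ᵖ` of `p`-frames. -/
abbrev H (p : ℕ) {d : ℕ} (Ω : Opens (Space d)) : Type := Fin p → H10 Ω

/-- The inner product `(v, w)_L = ∑ⱼ ∫_Ω vⱼ wⱼ` of `L = [L²(Ω)]ᵖ`, on `p`-frames of `H ⊆ L`. -/
def innerL {p d : ℕ} {Ω : Opens (Space d)} (v w : H p Ω) : ℝ :=
  ∑ j, ∫ x in (Ω : Set (Space d)), (v j).1 x * (w j).1 x

/-- The norm `‖v‖_L`. -/
def normL {p d : ℕ} {Ω : Opens (Space d)} (v : H p Ω) : ℝ :=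
  √(innerL v v)

/-- The inner product `(v, w)_H = ∑ⱼ ∫_Ω ∇vⱼ · ∇wⱼ + Vⱼ vⱼ wⱼ` of `H`, depending on the
potentials `V`. -/
def innerH {p d : ℕ} {Ω : Opens (Space d)} (V : Fin p → Space d → ℝ) (v w : H p Ω) : ℝ :=
  ∑ j, ∫ x in (Ω : Set (Space d)),
    (inner ℝ (grad (v j) x) (grad (w j) x) + V j x * (v j).1 x * (w j).1 x)

/-- The norm `‖v‖_H` induced by `innerH`. -/
def normH {p d : ℕ} {Ω : Opens (Space d)} (V : Fin p → Space d → ℝ) (v : H p Ω) : ℝ :=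
  √(innerH V v v)

/-- The nonlinearity `ρⱼ(φ) = ∑ᵢ κᵢⱼ |φᵢ|²`. -/
def rho {p d : ℕ} {Ω : Opens (Space d)} (K : Matrix (Fin p) (Fin p) ℝ) (φ : H p Ω) (j : Fin p)
    (x : Space d) : ℝ :=
  ∑ i, K i j * |(φ i).1 x| ^ 2

/-- The integrand `∇vⱼ · ∇wⱼ + Vⱼ vⱼ wⱼ + ρⱼ(φ) vⱼ wⱼ` of the `j`-th term of `a_φ(v, w)`. -/
def aIntegrand {p d : ℕ} {Ω : Opens (Space d)} (V : Fin p → Space d → ℝ)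
    (K : Matrix (Fin p) (Fin p) ℝ) (φ v w : H p Ω) (j : Fin p) (x : Space d) : ℝ :=
  inner ℝ (grad (v j) x) (grad (w j) x) + V j x * (v j).1 x * (w j).1 x
    + rho K φ j x * (v j).1 x * (w j).1 x

/-- The form `a_φ(v, w) = ∑ⱼ ∫_Ω ∇vⱼ · ∇wⱼ + Vⱼ vⱼ wⱼ + ρⱼ(φ) vⱼ wⱼ`. -/
def aForm {p d : ℕ} {Ω : Opens (Space d)} (V : Fin p → Space d → ℝ)
    (K : Matrix (Fin p) (Fin p) ℝ) (φ v w : H p Ω) : ℝ :=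
  ∑ j, ∫ x in (Ω : Set (Space d)), aIntegrand V K φ v w j x

end GrossPitaevskii

end

open GrossPitaevskii

namespace GrossPitaevskii

instance : ENNReal.HolderTriple 6 6 3 where
  inv_add_inv_eq_inv := by
    rw [← ENNReal.toReal_eq_toReal_iff' (by simp) (by simp),
      ENNReal.toReal_add (by simp) (by simp)]
    norm_num

instance : ENNReal.HolderTriple 3 6 2 where
  inv_add_inv_eq_inv := by
    rw [← ENNReal.toReal_eq_toReal_iff' (by simp) (by simp),
      ENNReal.toReal_add (by simp) (by simp)]
    norm_num

section Sobolev

variable {d : ℕ} {Ω : Opens (Space d)}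

lemma norm_gradient (u : Space d → ℝ) (x : Space d) : ‖∇ u x‖ = ‖fderiv ℝ u x‖ := by
  simp [gradient]

/-- A compactly supported `C¹` function on the line is bounded by the total variation. -/
lemma enorm_le_lintegral_fderiv {u : Space 1 → ℝ} (hu : ContDiff ℝ 1 u)
    (h2u : HasCompactSupport u) (x : Space 1) :
    ‖u x‖ₑ ≤ ∫⁻ y, ‖fderiv ℝ u y‖ₑ := by
  let e : ℝ ≃L[ℝ] Space 1 :=
    (ContinuousLinearEquiv.funUnique (Fin 1) ℝ ℝ).symm.trans
      (EuclideanSpace.equiv (Fin 1) ℝ).symm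
  have he : MeasurePreserving e :=
    (PiLp.volume_preserving_toLp (Fin 1)).comp
      (volume_preserving_funUnique (Fin 1) ℝ).symm
  have hnorm : ∀ t : ℝ, ‖e t‖ = ‖t‖ := fun t => by
    rw [EuclideanSpace.norm_eq]; simp [e, Real.sqrt_sq_eq_abs]
  obtain ⟨t, rfl⟩ := e.surjective x
  calc ‖u (e t)‖ₑ ≤ ∫⁻ s in Set.Iic t, ‖deriv (u ∘ e) s‖ₑ :=
        HasCompactSupport.enorm_le_lintegral_Ici_deriv (hu.comp e.contDiff)
          (h2u.comp_homeomorph e.toHomeomorph) t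
    _ ≤ ∫⁻ s, ‖deriv (u ∘ e) s‖ₑ := setLIntegral_le_lintegral _ _
    _ ≤ ∫⁻ s, ‖fderiv ℝ u (e s)‖ₑ := by
        refine lintegral_mono fun s => ?_
        have h : deriv (u ∘ e) s = fderiv ℝ u (e s) (e 1) := by
          have := ((hu.differentiable (by simp) (e s)).hasFDerivAt.comp_hasDerivAt s
            (e.hasFDerivAt (x := s)).hasDerivAt)
          simpa using this.deriv
        rw [h]
        refine (ContinuousLinearMap.le_opENorm _ _).trans (le_of_eq ?_)
        rw [← ofReal_norm (e 1), hnorm]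
        simp
    _ = ∫⁻ y, ‖fderiv ℝ u y‖ₑ :=
        he.lintegral_comp_emb e.toHomeomorph.measurableEmbedding (fun y => ‖fderiv ℝ u y‖ₑ)

lemma eLpNorm_fderiv_eq_gradient (ψ : 𝓓(Ω, ℝ)) (q : ℝ≥0∞) :
    eLpNorm (fderiv ℝ ψ) q volume
      = eLpNorm (∇ ψ) q (volume.restrict (Ω : Set (Space d))) := by
  rw [← eLpNorm_restrict_eq_of_support_subset (f := fderiv ℝ ψ)
    ((support_fderiv_subset ℝ).trans ψ.tsupport_subset)]
  exact eLpNorm_congr_norm_ae (.of_forall fun x => (norm_gradient ψ x).symm)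

lemma eLpNorm_gradient_le {q : ℝ≥0∞} (hq : q ≤ 2)
    (ψ : 𝓓(Ω, ℝ)) :
    eLpNorm (∇ ψ) q (volume.restrict (Ω : Set (Space d)))
      ≤ eLpNorm (∇ ψ) 2 (volume.restrict (Ω : Set (Space d)))
        * volume (Ω : Set (Space d)) ^ (1 / q.toReal - 1 / 2) := by
  simpa using eLpNorm_le_eLpNorm_mul_rpow_measure_univ hq (memLp_gradient ψ).1

/-- The Sobolev inequality for test functions, `d ≤ 3`. -/
lemma exists_eLpNorm_six_test_le (hd : 1 ≤ d ∧ d ≤ 3)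
    (hΩb : Bornology.IsBounded (Ω : Set (Space d))) :
    ∃ C : ℝ≥0∞, C ≠ ⊤ ∧ ∀ ψ : 𝓓(Ω, ℝ),
      eLpNorm ψ 6 (volume.restrict (Ω : Set (Space d)))
        ≤ C * eLpNorm (∇ ψ) 2 (volume.restrict (Ω : Set (Space d))) := by
  have hfin : volume (Ω : Set (Space d)) ≠ ⊤ := hΩb.measure_lt_top.ne
  suffices h : ∃ q : ℝ≥0∞, 1 ≤ q ∧ q ≤ 2 ∧ ∃ C : ℝ≥0∞, C ≠ ⊤ ∧ ∀ ψ : 𝓓(Ω, ℝ),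
      eLpNorm ψ 6 (volume.restrict (Ω : Set (Space d))) ≤ C * eLpNorm (fderiv ℝ ψ) q volume by
    obtain ⟨q, hq1, hq, C, hC, h⟩ := h
    refine ⟨C * volume (Ω : Set (Space d)) ^ (1 / q.toReal - 1 / 2),
      ENNReal.mul_ne_top hC (ENNReal.rpow_ne_top_of_nonneg ?_ hfin), fun ψ => ?_⟩
    · have h1 : q ≠ ⊤ := (hq.trans_lt (by simp)).ne
      have h2 : q.toReal ≤ 2 := ENNReal.toReal_le_of_le_ofReal (by norm_num) (by simpa using hq)
      have h3 : 0 < q.toReal := ENNReal.toReal_pos (one_pos.trans_le hq1).ne' h1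
      exact sub_nonneg.2 (one_div_le_one_div_of_le h3 h2)
    · refine (h ψ).trans ?_
      rw [eLpNorm_fderiv_eq_gradient]
      refine (mul_le_mul_right (eLpNorm_gradient_le hq ψ) _).trans_eq ?_
      ring
  have key : ∀ q : NNReal, 1 ≤ q → q < d → (q : ℝ)⁻¹ - (d : ℝ)⁻¹ ≤ 6⁻¹ →
      ∃ C : ℝ≥0∞, C ≠ ⊤ ∧ ∀ ψ : 𝓓(Ω, ℝ),
      eLpNorm ψ 6 (volume.restrict (Ω : Set (Space d)))
        ≤ C * eLpNorm (fderiv ℝ ψ) q volume := by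
    intro q h1 h2 h3
    refine ⟨eLpNormLESNormFDerivOfLeConst ℝ volume (Ω : Set (Space d)) q 6, by simp, fun ψ => ?_⟩
    have := eLpNorm_le_eLpNorm_fderiv_of_le (q := 6) volume (ψ.contDiff.of_le (by simp))
      ((subset_tsupport _).trans ψ.tsupport_subset) h1 (by simpa using h2) (by simpa using h3) hΩb
    exact (eLpNorm_mono_measure _ Measure.restrict_le_self).trans (by simpa using this)
  obtain ⟨hd1, hd3⟩ := hd
  interval_cases d
  · refine ⟨1, le_rfl, by norm_num, volume (Ω : Set (Space 1)) ^ (6 : ℝ)⁻¹,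
      ENNReal.rpow_ne_top_of_nonneg (by norm_num) hfin, fun ψ => ?_⟩
    have h := eLpNorm_le_of_ae_enorm_bound (p := 6) (f := ψ)
      (μ := volume.restrict (Ω : Set (Space 1)))
      (.of_forall (enorm_le_lintegral_fderiv (ψ.contDiff.of_le (by simp)) ψ.hasCompactSupport))
    rw [eLpNorm_one_eq_lintegral_enorm, mul_comm]
    simpa [mul_comm] using h
  · refine ⟨((3 / 2 : NNReal) : ℝ≥0∞), ?_, ?_, key (3 / 2) ?_ ?_ ?_⟩
    · exact_mod_cast (by rw [le_div_iff₀] <;> norm_num : (1 : NNReal) ≤ 3 / 2)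
    · exact_mod_cast (by rw [div_le_iff₀] <;> norm_num : (3 / 2 : NNReal) ≤ 2)
    · rw [le_div_iff₀] <;> norm_num
    · rw [div_lt_iff₀] <;> norm_num
    · norm_num
  · exact ⟨((2 : NNReal) : ℝ≥0∞), by norm_num, by norm_num,
      key 2 (by norm_num) (by norm_num) (by norm_num)⟩

/-- The Sobolev inequality in `H¹₀(Ω)`, `d ≤ 3`. -/
lemma exists_eLpNorm_six_le (hd : 1 ≤ d ∧ d ≤ 3)
    (hΩb : Bornology.IsBounded (Ω : Set (Space d))) :
    ∃ C : ℝ≥0∞, C ≠ ⊤ ∧ ∀ v : H10 Ω,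
      eLpNorm v.1 6 (volume.restrict (Ω : Set (Space d)))
        ≤ C * eLpNorm (grad v) 2 (volume.restrict (Ω : Set (Space d))) := by
  obtain ⟨C, hC, h⟩ := exists_eLpNorm_six_test_le hd hΩb
  refine ⟨C, hC, fun v => ?_⟩
  obtain ⟨ψ, h1, h2⟩ : ∃ ψ, TendstoH1 ψ v.1 (grad v) := v.2.choose_spec.2
  have hm : TendstoInMeasure (volume.restrict (Ω : Set (Space d))) (fun n => ψ n) atTop v.1 :=
    tendstoInMeasure_of_tendsto_eLpNorm (by norm_num) (fun n => (memLp_test (ψ n)).1)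
      (Lp.memLp v.1).1 h1
  obtain ⟨ns, hns, hae⟩ := hm.exists_seq_tendsto_ae
  have hb : ∀ n, eLpNorm (ψ n) 6 (volume.restrict (Ω : Set (Space d)))
      ≤ C * (eLpNorm (fun x => ∇ (ψ n) x - grad v x) 2 (volume.restrict (Ω : Set (Space d)))
        + eLpNorm (grad v) 2 (volume.restrict (Ω : Set (Space d)))) := fun n => by
    refine (h (ψ n)).trans (mul_le_mul_right ?_ _)
    have hs : (fun x => ∇ (ψ n) x - grad v x) + grad v = ∇ (ψ n) := by ext1 x; simp
    refine (le_of_eq (by rw [hs])).trans (eLpNorm_add_le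
      ((memLp_gradient (ψ n)).sub (Lp.memLp (grad v))).1 (Lp.memLp (grad v)).1 (by norm_num))
  have hlim : Tendsto (fun n => C * (eLpNorm (fun x => ∇ (ψ (ns n)) x - grad v x) 2
      (volume.restrict (Ω : Set (Space d)))
        + eLpNorm (grad v) 2 (volume.restrict (Ω : Set (Space d))))) atTop
      (𝓝 (C * eLpNorm (grad v) 2 (volume.restrict (Ω : Set (Space d))))) := by
    refine ENNReal.Tendsto.const_mul ?_ (Or.inr hC)
    simpa using (h2.comp hns.tendsto_atTop).add_const
      (eLpNorm (grad v) 2 (volume.restrict (Ω : Set (Space d))))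
  refine (Lp.eLpNorm_lim_le_liminf_eLpNorm (fun n => (memLp_test (ψ (ns n))).1) _ hae).trans ?_
  exact (liminf_le_liminf (.of_forall fun n => hb (ns n))).trans_eq hlim.liminf_eq

end Sobolev

section Forms

variable {d p : ℕ} {Ω : Opens (Space d)}

lemma grad_add (u v : H10 Ω) : grad (u + v) = grad u + grad v :=
  (grad_spec (u + v)).unique ((grad_spec u).add (grad_spec v))

lemma grad_smul (c : ℝ) (u : H10 Ω) : grad (c • u) = c • grad u :=
  (grad_spec (c • u)).unique ((grad_spec u).smul c)

/-- The Sobolev inequality, with the norms of `L²(Ω)` and `L⁶(Ω)` as real numbers. -/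
lemma exists_memLp_six (hd : 1 ≤ d ∧ d ≤ 3)
    (hΩb : Bornology.IsBounded (Ω : Set (Space d))) :
    ∃ S : ℝ, 0 ≤ S ∧ ∀ v : H10 Ω, MemLp v.1 6 (volume.restrict (Ω : Set (Space d))) ∧
      (eLpNorm v.1 6 (volume.restrict (Ω : Set (Space d)))).toReal ≤ S * ‖grad v‖ := by
  obtain ⟨C, hC, h⟩ := exists_eLpNorm_six_le hd hΩb
  refine ⟨C.toReal, ENNReal.toReal_nonneg, fun v => ?_⟩
  have hfin : C * eLpNorm (grad v) 2 (volume.restrict (Ω : Set (Space d))) ≠ ⊤ :=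
    ENNReal.mul_ne_top hC (Lp.eLpNorm_ne_top _)
  refine ⟨⟨(Lp.memLp v.1).1, (h v).trans_lt hfin.lt_top⟩, ?_⟩
  rw [Lp.norm_def, ← ENNReal.toReal_mul]
  exact ENNReal.toReal_mono hfin (h v)

/-- The Poincaré inequality. -/
lemma exists_norm_le_norm_grad (hd : 1 ≤ d ∧ d ≤ 3)
    (hΩb : Bornology.IsBounded (Ω : Set (Space d))) :
    ∃ P : ℝ, 0 ≤ P ∧ ∀ v : H10 Ω, ‖v.1‖ ≤ P * ‖grad v‖ := by
  obtain ⟨S, hS, h⟩ := exists_memLp_six hd hΩb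
  have hfin : volume (Ω : Set (Space d)) ^ (1 / 2 - 1 / 6 : ℝ) ≠ ⊤ :=
    ENNReal.rpow_ne_top_of_nonneg (by norm_num) hΩb.measure_lt_top.ne
  refine ⟨S * (volume (Ω : Set (Space d)) ^ (1 / 2 - 1 / 6 : ℝ)).toReal, by positivity,
    fun v => ?_⟩
  have h1 := eLpNorm_le_eLpNorm_mul_rpow_measure_univ (p := 2) (q := 6)
    (by norm_num) (h v).1.1
  rw [Measure.restrict_apply_univ, ENNReal.toReal_ofNat, ENNReal.toReal_ofNat] at h1
  have h2 := ENNReal.toReal_mono (ENNReal.mul_ne_top (h v).1.2.ne hfin) h1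
  rw [ENNReal.toReal_mul] at h2
  rw [Lp.norm_def]
  calc _ ≤ _ := h2
    _ ≤ S * ‖grad v‖ * _ := mul_le_mul_of_nonneg_right (h v).2 ENNReal.toReal_nonneg
    _ = _ := by ring

lemma integrable_and_abs_integral_mul_le {f g : Space d → ℝ}
    (hf : MemLp f 2 (volume.restrict (Ω : Set (Space d))))
    (hg : MemLp g 2 (volume.restrict (Ω : Set (Space d)))) :
    Integrable (fun x => f x * g x) (volume.restrict (Ω : Set (Space d))) ∧
    |∫ x in (Ω : Set (Space d)), f x * g x|
      ≤ (eLpNorm f 2 (volume.restrict (Ω : Set (Space d)))).toReal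
        * (eLpNorm g 2 (volume.restrict (Ω : Set (Space d)))).toReal := by
  refine ⟨hf.integrable_mul hg, ?_⟩
  have h := abs_real_inner_le_norm (hf.toLp f) (hg.toLp g)
  rw [L2.inner_def, Lp.norm_toLp, Lp.norm_toLp] at h
  convert! h using 2
  refine integral_congr_ae ?_
  filter_upwards [hf.coeFn_toLp, hg.coeFn_toLp] with x h1 h2
  rw [h1, h2]
  simp [mul_comm]

/-- Hölder's inequality with exponents `3`, `6`, `2`. -/
lemma integrable_and_abs_integral_mul_mul_le {W f g : Space d → ℝ}
    (hW : MemLp W 3 (volume.restrict (Ω : Set (Space d))))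
    (hf : MemLp f 6 (volume.restrict (Ω : Set (Space d))))
    (hg : MemLp g 2 (volume.restrict (Ω : Set (Space d)))) :
    Integrable (fun x => W x * f x * g x) (volume.restrict (Ω : Set (Space d))) ∧
    |∫ x in (Ω : Set (Space d)), W x * f x * g x|
      ≤ (eLpNorm W 3 (volume.restrict (Ω : Set (Space d)))).toReal
        * (eLpNorm f 6 (volume.restrict (Ω : Set (Space d)))).toReal
        * (eLpNorm g 2 (volume.restrict (Ω : Set (Space d)))).toReal := by
  have hWf : MemLp (W * f) 2 (volume.restrict (Ω : Set (Space d))) :=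
    MemLp.mul (p := 3) (q := 6) hf hW
  obtain ⟨h1, h2⟩ := integrable_and_abs_integral_mul_le hWf hg
  refine ⟨h1, h2.trans (mul_le_mul_of_nonneg_right ?_ ENNReal.toReal_nonneg)⟩
  have h3 := eLpNorm_smul_le_mul_eLpNorm (p := 3) (q := 6) (r := 2) hf.1 hW.1
  rw [smul_eq_mul] at h3
  rw [← ENNReal.toReal_mul]
  exact ENNReal.toReal_mono (ENNReal.mul_ne_top hW.2.ne hf.2.ne) h3

/-- Multiplication by a function of `L³(Ω)` maps `H¹₀(Ω)` boundedly into `L²(Ω)`, so that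
`∫_Ω W v w` is controlled by `‖∇v‖ ‖w‖`. -/
lemma exists_weight_bound (hd : 1 ≤ d ∧ d ≤ 3)
    (hΩb : Bornology.IsBounded (Ω : Set (Space d))) {W : Space d → ℝ}
    (hW : MemLp W 3 (volume.restrict (Ω : Set (Space d)))) :
    ∃ A : ℝ, 0 ≤ A ∧ ∀ v w : H10 Ω,
      Integrable (fun x => W x * v.1 x * w.1 x) (volume.restrict (Ω : Set (Space d))) ∧
      |∫ x in (Ω : Set (Space d)), W x * v.1 x * w.1 x| ≤ A * ‖grad v‖ * ‖w.1‖ := by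
  obtain ⟨S, hS, h⟩ := exists_memLp_six hd hΩb
  refine ⟨(eLpNorm W 3 (volume.restrict (Ω : Set (Space d)))).toReal * S,
    mul_nonneg ENNReal.toReal_nonneg hS, fun v w => ?_⟩
  obtain ⟨h1, h2⟩ := integrable_and_abs_integral_mul_mul_le hW (h v).1 (Lp.memLp w.1)
  refine ⟨h1, h2.trans ?_⟩
  rw [Lp.norm_def w.1, mul_assoc _ S]
  exact mul_le_mul_of_nonneg_right (mul_le_mul_of_nonneg_left (h v).2 ENNReal.toReal_nonneg)
    ENNReal.toReal_nonneg

lemma memLp_rho (hd : 1 ≤ d ∧ d ≤ 3)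
    (hΩb : Bornology.IsBounded (Ω : Set (Space d))) (K : Matrix (Fin p) (Fin p) ℝ)
    (φ : H p Ω) (j : Fin p) :
    MemLp (rho K φ j) 3 (volume.restrict (Ω : Set (Space d))) := by
  obtain ⟨S, hS, h⟩ := exists_memLp_six hd hΩb
  refine memLp_finsetSum _ fun i _ => MemLp.const_mul ?_ _
  have hi : MemLp (fun x => (φ i).1 x * (φ i).1 x) 3 (volume.restrict (Ω : Set (Space d))) :=
    (h (φ i)).1.mul' (h (φ i)).1
  simpa only [sq_abs, pow_two, abs_mul_abs_self] using hi

lemma integrable_inner_grad (v w : H10 Ω) :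
    Integrable (fun x => inner ℝ (grad v x) (grad w x))
      (volume.restrict (Ω : Set (Space d))) :=
  L2.integrable_inner _ _

lemma integral_inner_grad (v w : H10 Ω) :
    ∫ x in (Ω : Set (Space d)), inner ℝ (grad v x) (grad w x) = inner ℝ (grad v) (grad w) :=
  (L2.inner_def _ _).symm

lemma aIntegrand_comm (V : Fin p → Space d → ℝ) (K : Matrix (Fin p) (Fin p) ℝ)
    (φ v w : H p Ω) (j : Fin p) : aIntegrand V K φ v w j = aIntegrand V K φ w v j := by
  ext x
  simp only [aIntegrand, real_inner_comm]
  ring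

lemma aForm_comm (V : Fin p → Space d → ℝ) (K : Matrix (Fin p) (Fin p) ℝ)
    (φ v w : H p Ω) : aForm V K φ v w = aForm V K φ w v := by
  simp only [aForm, aIntegrand_comm V K φ v w]

lemma aForm_smul_left (V : Fin p → Space d → ℝ) (K : Matrix (Fin p) (Fin p) ℝ)
    (φ : H p Ω) (c : ℝ) (v w : H p Ω) :
    aForm V K φ (c • v) w = c * aForm V K φ v w := by
  simp only [aForm, Finset.mul_sum]
  refine Finset.sum_congr rfl fun j _ => ?_
  rw [← integral_const_mul]
  refine integral_congr_ae ?_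
  filter_upwards [Lp.coeFn_smul c (v j).1, Lp.coeFn_smul c (grad (v j))] with x h1 h2
  simp only [aIntegrand, Pi.smul_apply, grad_smul, Submodule.coe_smul, h1, h2,
    real_inner_smul_left, smul_eq_mul]
  ring

lemma aForm_add_left {V : Fin p → Space d → ℝ} {K : Matrix (Fin p) (Fin p) ℝ}
    {φ : H p Ω} (hint : ∀ v w : H p Ω, ∀ j,
      Integrable (aIntegrand V K φ v w j) (volume.restrict (Ω : Set (Space d))))
    (u v w : H p Ω) :
    aForm V K φ (u + v) w = aForm V K φ u w + aForm V K φ v w := by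
  simp only [aForm, ← Finset.sum_add_distrib]
  refine Finset.sum_congr rfl fun j _ => ?_
  rw [← integral_add (hint u w j) (hint v w j)]
  refine integral_congr_ae ?_
  filter_upwards [Lp.coeFn_add (u j).1 (v j).1, Lp.coeFn_add (grad (u j)) (grad (v j))]
    with x h1 h2
  simp only [aIntegrand, Pi.add_apply, grad_add, Submodule.coe_add, h1, h2, inner_add_left]
  ring

lemma normL_sq (v : H p Ω) : normL v ^ 2 = ∑ j, ‖(v j).1‖ ^ 2 := by
  have h : innerL v v = ∑ j, ‖(v j).1‖ ^ 2 := by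
    refine Finset.sum_congr rfl fun j _ => ?_
    rw [← real_inner_self_eq_norm_sq, L2.inner_def]
    simp [pow_two]
  rw [normL, h, Real.sq_sqrt (by positivity)]

lemma innerH_self {V : Fin p → Space d → ℝ} (v : H p Ω)
    (hint : ∀ j, Integrable (fun x => V j x * (v j).1 x * (v j).1 x)
      (volume.restrict (Ω : Set (Space d)))) :
    innerH V v v
      = ∑ j, (‖grad (v j)‖ ^ 2 + ∫ x in (Ω : Set (Space d)), V j x * (v j).1 x * (v j).1 x) := by
  refine Finset.sum_congr rfl fun j _ => ?_
  rw [integral_add (integrable_inner_grad _ _) (hint j), integral_inner_grad,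
    real_inner_self_eq_norm_sq]

lemma potential_nonneg {V : Space d → ℝ}
    (hV0 : ∀ᵐ x ∂(volume.restrict (Ω : Set (Space d))), 0 ≤ V x) (v : H10 Ω) :
    0 ≤ ∫ x in (Ω : Set (Space d)), V x * v.1 x * v.1 x := by
  refine integral_nonneg_of_ae ?_
  filter_upwards [hV0] with x hx
  rw [mul_assoc]
  exact mul_nonneg hx (mul_self_nonneg _)

lemma abs_integral_aIntegrand_le {V : Fin p → Space d → ℝ} {K : Matrix (Fin p) (Fin p) ℝ}
    {φ v w : H p Ω} {j : Fin p} {A B : ℝ}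
    (hA : Integrable (fun x => V j x * (v j).1 x * (w j).1 x)
        (volume.restrict (Ω : Set (Space d))) ∧
      |∫ x in (Ω : Set (Space d)), V j x * (v j).1 x * (w j).1 x| ≤ A)
    (hB : Integrable (fun x => rho K φ j x * (v j).1 x * (w j).1 x)
        (volume.restrict (Ω : Set (Space d))) ∧
      |∫ x in (Ω : Set (Space d)), rho K φ j x * (v j).1 x * (w j).1 x| ≤ B) :
    |∫ x in (Ω : Set (Space d)), aIntegrand V K φ v w j x|
      ≤ ‖grad (v j)‖ * ‖grad (w j)‖ + A + B := by
  have h := integral_add ((integrable_inner_grad (v j) (w j)).add hA.1) hB.1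
  simp only [Pi.add_apply] at h
  rw [show (∫ x in (Ω : Set (Space d)), aIntegrand V K φ v w j x) = _ from h,
    integral_add (integrable_inner_grad _ _) hA.1, integral_inner_grad]
  exact (abs_add_three _ _ _).trans
    (add_le_add (add_le_add (abs_real_inner_le_norm _ _) hA.2) hB.2)

end Forms

end GrossPitaevskii

theorem mainTheorem10 (d p : ℕ) (hd : 1 ≤ d ∧ d ≤ 3) (hp : 1 ≤ p)
    (Ω : TopologicalSpace.Opens (Space d))
    (hΩb : Bornology.IsBounded (Ω : Set (Space d))) (hΩc : Convex ℝ (Ω : Set (Space d)))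
    (V : Fin p → Space d → ℝ)
    (hV : ∀ j, MemLp (V j) ∞ (volume.restrict (Ω : Set (Space d))))
    (hV0 : ∀ j, ∀ᵐ x ∂(volume.restrict (Ω : Set (Space d))), 0 ≤ V j x)
    (K : Matrix (Fin p) (Fin p) ℝ) (φ : H p Ω) :
    (∀ v w : H p Ω, ∀ j,
      Integrable (aIntegrand V K φ v w j) (volume.restrict (Ω : Set (Space d)))) ∧
    (∃ B : LinearMap.BilinForm ℝ (H p Ω), ∀ v w, B v w = aForm V K φ v w) ∧
    (∀ v w : H p Ω, aForm V K φ v w = aForm V K φ w v) ∧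
    (∃ M : ℝ, ∀ v w : H p Ω, |aForm V K φ v w| ≤ M * normH V v * normH V w) ∧
    (∃ C : ℝ, 0 < C ∧ ∀ v : H p Ω,
      aForm V K φ v v ≥ 1 / 2 * normH V v ^ 2 - C * normL v ^ 2) := by
  have hfin : IsFiniteMeasure (volume.restrict (Ω : Set (Space d))) :=
    isFiniteMeasure_restrict.2 hΩb.measure_lt_top.ne
  choose A hA0 hA using fun j => exists_weight_bound hd hΩb ((hV j).mono_exponent le_top)
  choose B hB0 hB using fun j => exists_weight_bound hd hΩb (memLp_rho hd hΩb K φ j)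
  obtain ⟨P, hP0, hP⟩ := exists_norm_le_norm_grad hd hΩb
  have hint : ∀ v w : H p Ω, ∀ j,
      Integrable (aIntegrand V K φ v w j) (volume.restrict (Ω : Set (Space d))) := fun v w j =>
    ((integrable_inner_grad (v j) (w j)).add (hA j (v j) (w j)).1).add (hB j (v j) (w j)).1
  have hH : ∀ v : H p Ω, innerH V v v = ∑ j, (‖grad (v j)‖ ^ 2
      + ∫ x in (Ω : Set (Space d)), V j x * (v j).1 x * (v j).1 x) := fun v =>
    innerH_self v fun j => (hA j (v j) (v j)).1
  have hpos : ∀ (v : H p Ω) j, 0 ≤ ‖grad (v j)‖ ^ 2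
      + ∫ x in (Ω : Set (Space d)), V j x * (v j).1 x * (v j).1 x := fun v j =>
    add_nonneg (sq_nonneg _) (potential_nonneg (hV0 j) (v j))
  have hHsq : ∀ v : H p Ω, normH V v ^ 2 = ∑ j, (‖grad (v j)‖ ^ 2
      + ∫ x in (Ω : Set (Space d)), V j x * (v j).1 x * (v j).1 x) := fun v => by
    rw [normH, Real.sq_sqrt, hH]
    rw [hH]
    exact Finset.sum_nonneg fun j _ => hpos v j
  have hgrad : ∀ (v : H p Ω) j, ‖grad (v j)‖ ≤ normH V v := fun v j => by
    refine Real.le_sqrt_of_sq_le ?_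
    rw [hH]
    exact (le_add_of_nonneg_right (potential_nonneg (hV0 j) (v j))).trans
      (Finset.single_le_sum (fun i _ => hpos v i) (Finset.mem_univ j))
  refine ⟨hint, ⟨LinearMap.mk₂ ℝ (aForm V K φ) (aForm_add_left hint) (aForm_smul_left V K φ)
    (fun u v w => ?_) (fun c v w => ?_), fun _ _ => rfl⟩, aForm_comm V K φ,
    ⟨∑ j, (1 + A j * P + B j * P), fun v w => ?_⟩,
    ⟨1 + ∑ j, B j ^ 2 / 2, ?_, fun v => ?_⟩⟩
  · rw [aForm_comm, aForm_add_left hint, aForm_comm V K φ v, aForm_comm V K φ w]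
  · rw [aForm_comm, aForm_smul_left, aForm_comm V K φ w, smul_eq_mul]
  · rw [aForm, Finset.sum_mul, Finset.sum_mul]
    refine (Finset.abs_sum_le_sum_abs _ _).trans (Finset.sum_le_sum fun j _ => ?_)
    have hw := hP (w j)
    calc _ ≤ _ := abs_integral_aIntegrand_le (hA j (v j) (w j)) (hB j (v j) (w j))
      _ ≤ ‖grad (v j)‖ * ‖grad (w j)‖ + A j * ‖grad (v j)‖ * (P * ‖grad (w j)‖)
          + B j * ‖grad (v j)‖ * (P * ‖grad (w j)‖) := by
        have := hA0 j
        have := hB0 j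
        gcongr
      _ = (1 + A j * P + B j * P) * (‖grad (v j)‖ * ‖grad (w j)‖) := by ring
      _ ≤ (1 + A j * P + B j * P) * (normH V v * normH V w) := by
        have := hA0 j
        have := hB0 j
        have := hgrad v j
        have := hgrad w j
        have : 0 ≤ normH V v := Real.sqrt_nonneg _
        gcongr
      _ = _ := by ring
  · positivity
  · rw [hHsq, normL_sq, ge_iff_le, aForm, Finset.mul_sum, Finset.mul_sum,
      ← Finset.sum_sub_distrib]
    refine Finset.sum_le_sum fun j _ => ?_
    have h := integral_add ((integrable_inner_grad (v j) (v j)).add (hA j (v j) (v j)).1)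
      (hB j (v j) (v j)).1
    simp only [Pi.add_apply] at h
    rw [show (∫ x in (Ω : Set (Space d)), aIntegrand V K φ v v j x) = _ from h,
      integral_add (integrable_inner_grad _ _) (hA j (v j) (v j)).1, integral_inner_grad,
      real_inner_self_eq_norm_sq]
    have h1 := (abs_le.1 (hB j (v j) (v j)).2).1
    have h2 := potential_nonneg (hV0 j) (v j)
    have h3 : B j ^ 2 / 2 ≤ ∑ j, B j ^ 2 / 2 :=
      Finset.single_le_sum (f := fun j => B j ^ 2 / 2) (fun i _ => by positivity)
        (Finset.mem_univ j)
    have h4 := mul_le_mul_of_nonneg_right h3 (sq_nonneg ‖(v j).1‖)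
    nlinarith [sq_nonneg (‖grad (v j)‖ - B j * ‖(v j).1‖), sq_nonneg ‖(v j).1‖]
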